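/- Let $G$ be a finite group, $p$ a prime dividing $|G|$, and $G_p$ a Sylow $p$-subgroup of $G$. Let $\mathcal{F}$ be the set of all pairs $(H, N_G(H))$ where $H \subseteq G_p$ is a principal $p$-radical subgroup of $G$, that is, a $p$-subgroup $H$ such that $Z(H)$ is a Sylow $p$-subgroup of $C_G(H)$ and $N_G(H)/H\,C_G(H)$ has no non-trivial normal $p$-subgroup. Then $\mathcal{F}$ is a weak conjugation family in the sense of Alperin: whenever $A, B$ are subsets of $G_p$ and $B = g^{-1}Ag$ with $g \in G$, there are $n \ge 1$, elements $(H_1,T_1), \dots, (H_n,T_n)$ of $\mathcal{F}$ and elements $x_1, \dots, x_n, y$ of $G$ such that (1) $B = (x_1 x_2\cdots x_n y)^{-1} A (x_1 x_2 \cdots x_n y)$; (2) $x_i \in T_i$ for $1 \le i \le n$, and $y \in N_G(G_p)$; (3) $A \subseteq H_1$ and $(x_1\cdots x_i)^{-1} A (x_1 \cdots x_i) \subseteq H_{i+1}$ for $1 \le i \le n-1$. Moreover, $\mathcal{F}$ contains Goldschmidt's family $\mathcal{F}_0$, the set of all pairs $(H, N_G(H))$ with $H\subseteq G_p$ for which there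 is a Sylow $p$-subgroup $P$ of $G$ such that (a) $H = G_p \cap P$ is a tame intersection, i.e. $N_{G_p}(H)$ and $N_P(H)$ are Sylow $p$-subgroups of $N_G(H)$; (b) $C_{G_p}(H) \subseteq H$; (c) $H$ is a Sylow $p$-subgroup of $O_{p',p}(N_G(H))$, where $O_{p',p}(K)$ is the preimage in $K$ of the largest normal $p$-subgroup of $K/O_{p'}(K)$ and $O_{p'}(K)$ is the largest normal subgroup of $K$ of order prime to $p$; and (d) $H = P$, or $N_G(H)/H$ is $p$-isolated, where a group $Q$ is $p$-isolated if it has a proper subgroup $E$ with $p \mid |E|$ and $p \nmid |E \cap gEg^{-1}|$ for every $g \in Q \setminus E$. -/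

import Mathlib

/-- `Q` is a Sylow `p`-subgroup of the subgroup `K` of `G`. -/
def IsSylowIn {G : Type*} [Group G] (p : ℕ) (Q K : Subgroup G) : Prop :=
  ∃ S : Sylow p K, (S : Subgroup K).map K.subtype = Q

/-- A group has no non-trivial normal `p`-subgroup. -/
def HasNoNormalPSubgroup (p : ℕ) (Q : Type*) [Group Q] : Prop :=
  ∀ K : Subgroup Q, K.Normal → IsPGroup p K → K = ⊥

/-- A `p`-subgroup `P` of `G` is `p`-centric if `Z(P)` is a Sylow `p`-subgroup of `C_G(P)`. -/
def IsPCentric {G : Type*} [Group G] (p : ℕ) (P : Subgroup G) : Prop :=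
  IsPGroup p P ∧
    IsSylowIn p ((Subgroup.center P).map P.subtype) (Subgroup.centralizer (P : Set G))

/-- `P C_G(P)` is a normal subgroup of `N_G(P)`. -/
instance sup_centralizer_normal {G : Type*} [Group G] (P : Subgroup G) :
    ((P ⊔ Subgroup.centralizer (P : Set G)).subgroupOf
      (Subgroup.normalizer (P : Set G))).Normal := by
  have hC : Subgroup.centralizer (P : Set G) ≤ Subgroup.normalizer (P : Set G) := by
    intro c hc
    rw [Subgroup.mem_normalizer_iff]
    intro h
    rw [Subgroup.mem_centralizer_iff] at hc
    constructor
    · intro hh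
      rw [← hc h hh]
      simpa using hh
    · intro hh
      have h1 := hc _ hh
      have h2 : c * h * c⁻¹ = h := by
        have h3 : c * h = c * (c * h * c⁻¹) := by rw [← h1]; group
        exact (mul_left_cancel h3).symm
      rwa [h2] at hh
  rw [Subgroup.subgroupOf_sup Subgroup.le_normalizer hC]
  have hCn : ((Subgroup.centralizer (P : Set G)).subgroupOf
      (Subgroup.normalizer (P : Set G))).Normal := by
    refine ⟨fun c hc g => ?_⟩
    rw [Subgroup.mem_subgroupOf, Subgroup.mem_centralizer_iff] at hc ⊢
    intro h hh
    have hg := (Subgroup.mem_normalizer_iff''.1 g.2 h).1 hh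
    have h1 := hc _ hg
    have h2 : h * ((g : G) * c * (g : G)⁻¹) = g * ((g : G)⁻¹ * h * g * c) * (g : G)⁻¹ := by group
    have h3 : ((g : G) * c * (g : G)⁻¹) * h = g * (c * ((g : G)⁻¹ * h * g)) * (g : G)⁻¹ := by group
    simp only [Subgroup.coe_mul, Subgroup.coe_inv]
    rw [h2, h3, h1]
  infer_instance

/-- A subgroup `P` is principal `p`-radical if it is a `p`-centric `p`-subgroup and
`N_G(P) / P C_G(P)` has no non-trivial normal `p`-subgroup. -/
def IsPrincipalPRadical {G : Type*} [Group G] (p : ℕ) (P : Subgroup G) : Prop :=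
  IsPCentric p P ∧
    HasNoNormalPSubgroup p (Subgroup.normalizer (P : Set G) ⧸
      (P ⊔ Subgroup.centralizer (P : Set G)).subgroupOf (Subgroup.normalizer (P : Set G)))

/-- The conjugate `g⁻¹ A g` of a subset `A`. -/
def conjBy {G : Type*} [Group G] (g : G) (A : Set G) : Set G :=
  (fun a => g⁻¹ * a * g) '' A

/-- Alperin's weak conjugation families with respect to a Sylow `p`-subgroup `S` of `G`.
The sequences `(H i, T i)` and `x i` are indexed by `Fin n`, with `n ≥ 1`, and
`Fin.partialProd x i` is the product of the first `i` terms of `x`. -/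
structure IsWeakConjugationFamily {G : Type*} [Group G] {p : ℕ} (S : Sylow p G)
    (F : Set (Subgroup G × Set G)) : Prop where
  le_sylow : ∀ HT ∈ F, HT.1 ≤ S
  subset_normalizer : ∀ HT ∈ F, HT.2 ⊆ Subgroup.normalizer (HT.1 : Set G)
  exists_chain : ∀ (A B : Set G) (g : G), A ⊆ (S : Set G) → B ⊆ (S : Set G) → B = conjBy g A →
    ∃ (n : ℕ) (HT : Fin n → Subgroup G × Set G) (x : Fin n → G) (y : G),
      0 < n ∧ (∀ i, HT i ∈ F) ∧
      B = conjBy (Fin.partialProd x (Fin.last n) * y) A ∧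
      (∀ i, x i ∈ (HT i).2) ∧ y ∈ Subgroup.normalizer (S : Set G) ∧
      ∀ i : Fin n, conjBy (Fin.partialProd x i.castSucc) A ⊆ ((HT i).1 : Set G)

/-- The pairs `(H, N_G(H))` with `H ≤ S` principal `p`-radical in `G`. -/
def principalFamily {G : Type*} [Group G] {p : ℕ} (S : Sylow p G) :
    Set (Subgroup G × Set G) :=
  {HT | HT.1 ≤ S ∧ IsPrincipalPRadical p HT.1 ∧
    HT.2 = (Subgroup.normalizer (HT.1 : Set G) : Set G)}

/-- `H = Q ∩ R` is a tame intersection: `N_Q(H)` and `N_R(H)` are Sylow in `N_G(H)`. -/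
def IsTameIntersection {G : Type*} [Group G] {p : ℕ} (Q R : Sylow p G) (H : Subgroup G) : Prop :=
  H = (Q : Subgroup G) ⊓ (R : Subgroup G) ∧
    IsSylowIn p ((Q : Subgroup G) ⊓ Subgroup.normalizer (H : Set G))
      (Subgroup.normalizer (H : Set G)) ∧
    IsSylowIn p ((R : Subgroup G) ⊓ Subgroup.normalizer (H : Set G))
      (Subgroup.normalizer (H : Set G))

/-- `Q` is `p`-isolated: it has a strongly `p`-embedded subgroup `H`, that is, a proper subgroup
of order divisible by `p` such that `p ∤ |H ∩ g H g⁻¹|` for all `g` outside `H`. -/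
def IsPIsolated (p : ℕ) (Q : Type*) [Group Q] : Prop :=
  ∃ H : Subgroup Q, H ≠ ⊤ ∧ p ∣ Nat.card H ∧
    ∀ g : Q, g ∉ H →
      ¬ p ∣ Nat.card (H ⊓ H.map (MulAut.conj g).toMonoidHom : Subgroup Q)

/-- `O_p(K)`, generated by all normal `p`-subgroups. -/
def pCore (p : ℕ) (K : Type*) [Group K] : Subgroup K :=
  sSup {N : Subgroup K | N.Normal ∧ IsPGroup p N}

/-- `O_{p'}(K)`, generated by all normal subgroups of order prime to `p`
(`K` is a finite group). -/
def pPrimeCore (p : ℕ) (K : Type*) [Group K] : Subgroup K :=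
  sSup {N : Subgroup K | N.Normal ∧ (Nat.card N).Coprime p}

instance pPrimeCore_normal (p : ℕ) (K : Type*) [Group K] : (pPrimeCore p K).Normal :=
  Subgroup.sSup_normal _ fun _ h => h.1

/-- `O_{p',p}(K)`, the preimage in `K` of `O_p(K / O_{p'}(K))`. -/
def pPrimePCore (p : ℕ) (K : Type*) [Group K] : Subgroup K :=
  (pCore p (K ⧸ pPrimeCore p K)).comap (QuotientGroup.mk' (pPrimeCore p K))

/-- Goldschmidt's family of pairs `(H, N_G(H))` with `H ≤ S`. -/
def goldschmidtFamily {G : Type*} [Group G] {p : ℕ} (S : Sylow p G) :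
    Set (Subgroup G × Set G) :=
  {HT | HT.1 ≤ S ∧ HT.2 = (Subgroup.normalizer (HT.1 : Set G) : Set G) ∧
    ∃ P : Sylow p G,
      IsTameIntersection S P HT.1 ∧
      (S : Subgroup G) ⊓ Subgroup.centralizer (HT.1 : Set G) ≤ HT.1 ∧
      IsSylowIn p HT.1 ((pPrimePCore p (Subgroup.normalizer (HT.1 : Set G))).map
        (Subgroup.normalizer (HT.1 : Set G)).subtype) ∧
      (HT.1 = P ∨ IsPIsolated p (Subgroup.normalizer (HT.1 : Set G) ⧸
        HT.1.subgroupOf (Subgroup.normalizer (HT.1 : Set G))))}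

/-!
The first assertion is a form of Alperin's fusion theorem, proved by downward induction on the order
of a subgroup `P` of the Sylow subgroup `S`. It is shown for maps, not just for images
(`FusionGenerated`): every conjugation `P → S` is a composite of restrictions of conjugations by
elements of `N_G(H)`, where `H` runs through the principal `p`-radical subgroups in `S`. The sharper
form is what makes the induction work, since a composite on a larger subgroup has to restrict to
the right map on `P`.

Choose a conjugate `P'` of `P` in `S` which is fully normalized: `N_S(P')` is Sylow in `N_G(P')`.
A conjugation of `P < S` onto `P'`, followed by a suitable automorphism of `P'`, extends to
`N_S(P) > P` by Sylow's theorem, so that only conjugations of `P'` by elements of `N_G(P')` are left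
(`fusionGenerated_principalFamily`). If `P'` is principal `p`-radical, these belong to the
family. Otherwise `N_G(P')` has a normal subgroup `M`, either `C_G(P')` or the preimage of a normal
`p`-subgroup of `N_G(P') / P' C_G(P')`, which is contained in `C_G(P') (S ∩ M)` while `S ∩ M` is not
contained in `P'`. The Frattini argument replaces each element of `N_G(P')`, modulo `C_G(P')`, by
one which normalizes the larger group `P' (S ∩ M)` (`isPrincipalPRadical_or_exists_gt`).

For the second assertion, let `H` be a member of Goldschmidt's family and `N = N_G(H)`. As `H` is
fully normalized and contains `C_S(H)`, it is `p`-centric. Hence `C_G(H)` has a central Sylow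
`p`-subgroup, and Burnside's transfer theorem gives it a normal `p`-complement, which lies in
`O_{p'}(N)`. So the preimage `M` in `N` of a normal `p`-subgroup of `N / H C_G(H)` is a `p`-group
modulo `O_{p'}(N)`, that is, `M ≤ O_{p',p}(N)`. Since `H` is Sylow in the latter, it is Sylow in
`M`, and `M = H C_G(H)` (`goldschmidtFamily_subset_principalFamily`).
-/

open Subgroup


/-! ### Conjugates and Sylow subgroups of subgroups -/

section SylowIn

variable {G : Type*} [Group G] {p : ℕ} {Q R K M H P : Subgroup G}

/-- The conjugate subgroup `g⁻¹ H g`. -/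
def conjSubgroup (g : G) (H : Subgroup G) : Subgroup G :=
  H.comap (MulAut.conj g).toMonoidHom

theorem mem_conjSubgroup {g x : G} : x ∈ conjSubgroup g H ↔ g * x * g⁻¹ ∈ H := Iff.rfl

theorem conjSubgroup_mul (g h : G) :
    conjSubgroup (g * h) H = conjSubgroup h (conjSubgroup g H) := by
  ext x
  simp [mem_conjSubgroup, mul_assoc]

@[simp] theorem conjSubgroup_one : conjSubgroup 1 H = H := by
  ext x
  simp [mem_conjSubgroup]

theorem conjSubgroup_mono (g : G) (h : H ≤ K) : conjSubgroup g H ≤ conjSubgroup g K :=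
  comap_mono h

theorem conjSubgroup_le_iff {g : G} : conjSubgroup g H ≤ K ↔ H ≤ conjSubgroup g⁻¹ K := by
  constructor <;> intro h
  · simpa [← conjSubgroup_mul] using conjSubgroup_mono g⁻¹ h
  · simpa [← conjSubgroup_mul] using conjSubgroup_mono g h

theorem mem_normalizer_iff_conjSubgroup {g : G} :
    g ∈ normalizer (H : Set G) ↔ conjSubgroup g H = H := by
  rw [mem_normalizer_iff, SetLike.ext_iff]
  exact forall_congr' fun x => ⟨Iff.symm, Iff.symm⟩

theorem IsPGroup.conjSubgroup (h : IsPGroup p H) (g : G) : IsPGroup p (conjSubgroup g H) :=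
  h.comap_of_injective _ (MulAut.conj g).injective

theorem card_conjSubgroup (g : G) : Nat.card (conjSubgroup g H) = Nat.card H := by
  have : (conjSubgroup g H).map (MulAut.conj g).toMonoidHom = H :=
    map_comap_eq_self_of_surjective (MulAut.conj g).surjective H
  conv_rhs => rw [← this]
  exact (card_map_of_injective (MulAut.conj g).injective).symm

theorem conjSubgroup_normalizer (g : G) :
    conjSubgroup g (normalizer (H : Set G)) = normalizer (conjSubgroup g H : Set G) := by
  ext x
  rw [mem_conjSubgroup, mem_normalizer_iff_conjSubgroup, mem_normalizer_iff_conjSubgroup,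
    conjSubgroup_mul, conjSubgroup_mul]
  constructor <;> intro h
  · conv_rhs => rw [← h]
    rw [← conjSubgroup_mul g⁻¹ g, inv_mul_cancel, conjSubgroup_one]
  · rw [h, ← conjSubgroup_mul, mul_inv_cancel, conjSubgroup_one]

/-- Sylow subgroups of `K` are the maximal `p`-subgroups of `G` contained in `K`. -/
theorem isSylowIn_iff :
    IsSylowIn p Q K ↔ Q ≤ K ∧ IsPGroup p Q ∧ ∀ R ≤ K, IsPGroup p R → Q ≤ R → R = Q := by
  constructor
  · rintro ⟨S, rfl⟩
    refine ⟨map_subtype_le _, S.2.map _, fun R hRK hR hSR => ?_⟩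
    have h : R.subgroupOf K = S :=
      S.3 (hR.comap_of_injective _ K.subtype_injective) (map_le_iff_le_comap.1 hSR)
    rw [← h, map_subgroupOf_eq_of_le hRK]
  · rintro ⟨hQK, hQ, hmax⟩
    refine ⟨⟨Q.subgroupOf K, hQ.comap_of_injective _ K.subtype_injective, ?_⟩,
      map_subgroupOf_eq_of_le hQK⟩
    intro R hR hQR
    have h := hmax (R.map K.subtype) (map_subtype_le _) (hR.map _)
      (by simpa [map_subgroupOf_eq_of_le hQK] using map_mono (f := K.subtype) hQR)
    rw [← h]
    exact (comap_map_eq_self_of_injective K.subtype_injective R).symm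

theorem IsSylowIn.le (h : IsSylowIn p Q K) : Q ≤ K := (isSylowIn_iff.1 h).1

theorem IsSylowIn.isPGroup (h : IsSylowIn p Q K) : IsPGroup p Q := (isSylowIn_iff.1 h).2.1

theorem IsSylowIn.eq_of_le (h : IsSylowIn p Q K) (hRK : R ≤ K) (hR : IsPGroup p R)
    (hQR : Q ≤ R) : R = Q := (isSylowIn_iff.1 h).2.2 R hRK hR hQR

theorem exists_isSylowIn_ge (hR : IsPGroup p R) (hRK : R ≤ K) : ∃ Q, IsSylowIn p Q K ∧ R ≤ Q := by
  obtain ⟨S, hS⟩ := (hR.comap_of_injective K.subtype K.subtype_injective).exists_le_sylow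
  refine ⟨_, ⟨S, rfl⟩, ?_⟩
  rw [← map_subgroupOf_eq_of_le hRK]
  exact map_mono hS

theorem isSylowIn_top (S : Sylow p G) : IsSylowIn p (S : Subgroup G) ⊤ :=
  isSylowIn_iff.2 ⟨le_top, S.2, fun _ _ hR h => S.3 hR h⟩

variable [Finite G] [Fact p.Prime]

/-- Sylow's conjugacy theorem for subgroups of `K`. -/
theorem IsSylowIn.exists_conjSubgroup_le (h : IsSylowIn p Q K) (hRK : R ≤ K)
    (hR : IsPGroup p R) : ∃ k ∈ K, conjSubgroup k R ≤ Q := by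
  obtain ⟨S, rfl⟩ := h
  obtain ⟨T, hT⟩ := (hR.comap_of_injective K.subtype K.subtype_injective).exists_le_sylow
  obtain ⟨k, hk⟩ := MulAction.exists_smul_eq K S T
  refine ⟨k, k.2, fun x hx => ?_⟩
  rw [mem_conjSubgroup] at hx
  have h1 : (⟨_, hRK hx⟩ : K) ∈ (k • S : Sylow p K) := by
    rw [hk]
    exact hT hx
  have h2 : ((k⁻¹ * ⟨_, hRK hx⟩ * k : K) : G) ∈ (S : Subgroup K).map K.subtype := by
    refine ⟨k⁻¹ * ⟨_, hRK hx⟩ * k, ?_, rfl⟩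
    have h3 := (Sylow.smul_def (g := k) (P := S)) ▸ h1
    obtain ⟨s, hs, hs'⟩ := h3
    rw [← hs']
    simpa [mul_assoc] using hs
  simpa [mul_assoc] using h2

/-- A Sylow subgroup of `K` meets a normal subgroup of `K` in a Sylow subgroup. -/
theorem IsSylowIn.inf (h : IsSylowIn p Q K) (hMK : M ≤ K)
    (hM : K ≤ normalizer (M : Set G)) : IsSylowIn p (Q ⊓ M) M := by
  refine isSylowIn_iff.2 ⟨inf_le_right, h.isPGroup.to_le inf_le_left, fun R hRM hR hQR => ?_⟩
  obtain ⟨k, hk, hkR⟩ := h.exists_conjSubgroup_le (hRM.trans hMK) hR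
  have h1 : conjSubgroup k R ≤ Q ⊓ M := by
    refine le_inf hkR ?_
    rw [← mem_normalizer_iff_conjSubgroup.1 (hM hk)]
    exact conjSubgroup_mono k hRM
  refine (eq_of_le_of_card_ge hQR ?_).symm
  rw [← card_conjSubgroup k]
  exact card_le_of_le h1

/-- The Frattini argument. -/
theorem IsSylowIn.exists_mul_mem_normalizer (h : IsSylowIn p R M)
    (hM : K ≤ normalizer (M : Set G)) {n : G} (hn : n ∈ K) :
    ∃ m ∈ M, ∃ k ∈ normalizer (R : Set G), n = m * k := by
  obtain ⟨m, hm, hle⟩ := h.exists_conjSubgroup_le (R := conjSubgroup n⁻¹ R)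
    (by
      have := conjSubgroup_mono n⁻¹ h.le
      rwa [mem_normalizer_iff_conjSubgroup.1 (hM (inv_mem hn))] at this)
    (h.isPGroup.conjSubgroup _)
  rw [← conjSubgroup_mul] at hle
  have he : conjSubgroup (n⁻¹ * m) R = R :=
    eq_of_le_of_card_ge hle (card_conjSubgroup _).ge
  exact ⟨m, hm, (n⁻¹ * m)⁻¹, inv_mem (mem_normalizer_iff_conjSubgroup.2 he), by group⟩

/-- Every subgroup of a Sylow subgroup `S` has a fully normalized conjugate in `S`. -/
theorem exists_fullyNormalized_conj (S : Sylow p G) (hP : P ≤ S) :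
    ∃ g, conjSubgroup g P ≤ S ∧
      IsSylowIn p ((S : Subgroup G) ⊓ normalizer (conjSubgroup g P : Set G))
        (normalizer (conjSubgroup g P : Set G)) := by
  obtain ⟨T, hT, hPT⟩ := exists_isSylowIn_ge (S.2.to_le hP) (le_normalizer (H := P))
  obtain ⟨g, -, hg⟩ := (isSylowIn_top S).exists_conjSubgroup_le (le_top (a := T)) hT.isPGroup
  refine ⟨g, (conjSubgroup_mono g hPT).trans hg, isSylowIn_iff.2
    ⟨inf_le_right, S.2.to_le inf_le_left, fun R hRN hR hSR => ?_⟩⟩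
  have hTR : conjSubgroup g T ≤ (S : Subgroup G) ⊓ normalizer (conjSubgroup g P : Set G) :=
    le_inf hg (conjSubgroup_normalizer g ▸ conjSubgroup_mono g hT.le)
  have h1 : conjSubgroup g⁻¹ R = T := by
    refine hT.eq_of_le ?_ (hR.conjSubgroup _) (conjSubgroup_le_iff.1 (hTR.trans hSR))
    rw [conjSubgroup_le_iff, inv_inv, conjSubgroup_normalizer]
    exact hRN
  refine le_antisymm ?_ hSR
  refine le_trans ?_ hTR
  rw [← h1, ← conjSubgroup_mul]
  simp

end SylowIn

/-! ### Growth of normalizers and quotients which are `p`-groups -/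

section Growth

variable {G : Type*} [Group G] [Finite G] {p : ℕ} [Fact p.Prime] {P Q : Subgroup G}

/-- Normalizers grow in `p`-groups. -/
theorem IsPGroup.lt_inf_normalizer (hQ : IsPGroup p Q) (h : P < Q) :
    P < Q ⊓ normalizer (P : Set G) := by
  refine lt_of_le_of_ne (le_inf h.le le_normalizer) fun he => ?_
  have := hQ.isNilpotent
  have h1 : P.subgroupOf Q < ⊤ := by
    rw [lt_top_iff_ne_top, Ne, subgroupOf_eq_top]
    exact not_le_of_gt h
  obtain ⟨x, hx, hxP⟩ := SetLike.exists_of_lt (Group.normalizerCondition_of_isNilpotent _ h1)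
  refine hxP (mem_subgroupOf.2 ?_)
  rw [he]
  refine ⟨x.2, mem_normalizer_iff.2 fun y => ?_⟩
  rw [mem_normalizer_iff] at hx
  constructor <;> intro hy
  · exact (hx ⟨y, h.le hy⟩).1 hy
  · have hyQ : y ∈ Q := by
      have := mul_mem (mul_mem (inv_mem x.2) (h.le hy)) x.2
      simpa [mul_assoc] using this
    exact (hx ⟨y, hyQ⟩).2 hy

/-- A Sylow subgroup covers every quotient which is a `p`-group. -/
theorem Sylow.sup_eq_top_of_pow_mem {K : Type*} [Group K] [Finite K] (S : Sylow p K)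
    (D : Subgroup K) [D.Normal] (h : ∀ x, ∃ k, x ^ p ^ k ∈ D) : D ⊔ S = ⊤ := by
  have hq : IsPGroup p (K ⧸ D) := by
    intro x
    obtain ⟨x, rfl⟩ := QuotientGroup.mk_surjective x
    obtain ⟨k, hk⟩ := h x
    exact ⟨k, by rw [← QuotientGroup.mk_pow]; exact (QuotientGroup.eq_one_iff _).2 hk⟩
  obtain ⟨k, hk⟩ := IsPGroup.iff_card.1 hq
  have h1 : (D ⊔ S).index ∣ p ^ k := hk ▸ index_dvd_of_le le_sup_left
  have h2 : (D ⊔ S).index ∣ (S : Subgroup K).index := index_dvd_of_le le_sup_right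
  rw [← index_eq_one]
  obtain ⟨j, -, hj⟩ := (Nat.dvd_prime_pow Fact.out).1 h1
  rcases j with _ | j
  · simpa using hj
  · exact absurd ((dvd_pow_self p j.succ_ne_zero).trans (hj ▸ h2)) S.not_dvd_index

/-- If `M / D` is a `p`-group, then `M` is generated by `D` and a Sylow subgroup of `M`. -/
theorem IsSylowIn.le_sup_of_pow_mem {D M R : Subgroup G} (h : IsSylowIn p R M) (hDM : D ≤ M)
    (hD : M ≤ normalizer (D : Set G)) (hpow : ∀ x ∈ M, ∃ k, x ^ p ^ k ∈ D) : M ≤ D ⊔ R := by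
  obtain ⟨S, rfl⟩ := h
  have := (normal_subgroupOf_iff_le_normalizer hDM).2 hD
  have h1 := S.sup_eq_top_of_pow_mem (D.subgroupOf M) fun x => hpow x x.2
  have h2 := congrArg (Subgroup.map M.subtype) h1
  rw [Subgroup.map_sup, map_subgroupOf_eq_of_le hDM] at h2
  rw [h2, ← MonoidHom.range_eq_map, range_subtype]

end Growth


/-! ### Principal `p`-radical subgroups -/

section PrincipalPRadical

variable {G : Type*} [Group G] {p : ℕ} {P R M : Subgroup G}

theorem Subgroup.normalizer_le_normalizer_centralizer (P : Subgroup G) :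
    normalizer (P : Set G) ≤ normalizer (centralizer (P : Set G) : Set G) :=
  (normal_subgroupOf_iff_le_normalizer (centralizer_le_normalizer _)).1 inferInstance

theorem Subgroup.map_center_subtype (P : Subgroup G) :
    (center P).map P.subtype = P ⊓ centralizer (P : Set G) := by
  ext x
  simp only [mem_map, mem_center_iff, mem_inf, mem_centralizer_iff]
  constructor
  · rintro ⟨z, hz, rfl⟩
    exact ⟨z.2, fun a ha => congrArg Subtype.val (hz ⟨a, ha⟩)⟩
  · rintro ⟨hx, h⟩
    exact ⟨⟨x, hx⟩, fun a => Subtype.ext (h a a.2), rfl⟩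

/-- The condition on the quotient `N_G(P) / P C_G(P)`, in terms of subgroups of `G`. -/
theorem hasNoNormalPSubgroup_normalizer_quotient_iff :
    HasNoNormalPSubgroup p (normalizer (P : Set G) ⧸
      (P ⊔ centralizer (P : Set G)).subgroupOf (normalizer (P : Set G))) ↔
    ∀ M ≤ normalizer (P : Set G), normalizer (P : Set G) ≤ normalizer (M : Set G) →
      P ⊔ centralizer (P : Set G) ≤ M →
      (∀ x ∈ M, ∃ k, x ^ p ^ k ∈ P ⊔ centralizer (P : Set G)) →
      M ≤ P ⊔ centralizer (P : Set G) := by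
  set N := normalizer (P : Set G) with hN
  set D := P ⊔ centralizer (P : Set G) with hD
  constructor
  · intro h M hMN hNM hDM hpow
    have hM : (M.subgroupOf N).Normal := (normal_subgroupOf_iff_le_normalizer hMN).2 hNM
    have h1 := h ((M.subgroupOf N).map (QuotientGroup.mk' (D.subgroupOf N)))
      (hM.map _ (QuotientGroup.mk'_surjective _)) (by
        rintro ⟨_, x, hx, rfl⟩
        obtain ⟨k, hk⟩ := hpow x hx
        refine ⟨k, Subtype.ext ?_⟩
        change (QuotientGroup.mk' (D.subgroupOf N)) x ^ p ^ k = 1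
        rw [← map_pow]
        exact (QuotientGroup.eq_one_iff _).2 hk)
    intro x hx
    have h2 : (QuotientGroup.mk' (D.subgroupOf N)) ⟨x, hMN hx⟩ = 1 := by
      rw [← mem_bot, ← h1]
      exact mem_map_of_mem _ hx
    exact (QuotientGroup.eq_one_iff (N := D.subgroupOf N) (⟨x, hMN hx⟩ : N)).1 h2
  · intro h K hK hKp
    let M' := K.comap (QuotientGroup.mk' (D.subgroupOf N))
    have hDN : D ≤ N := sup_le le_normalizer (centralizer_le_normalizer (P : Set G))
    have h1 := h (M'.map N.subtype) (map_subtype_le _) (by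
        refine (normal_subgroupOf_iff_le_normalizer (map_subtype_le _)).1 ?_
        have : (M'.map N.subtype).subgroupOf N = M' :=
          comap_map_eq_self_of_injective N.subtype_injective M'
        rw [this]
        exact hK.comap _)
      (by
        intro x hx
        refine ⟨⟨x, hDN hx⟩, ?_, rfl⟩
        have : QuotientGroup.mk' (D.subgroupOf N) ⟨x, hDN hx⟩ = 1 :=
          (QuotientGroup.eq_one_iff _).2 hx
        change QuotientGroup.mk' (D.subgroupOf N) ⟨x, hDN hx⟩ ∈ K
        rw [this]
        exact one_mem K)
      (by
        rintro _ ⟨x, hx, rfl⟩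
        obtain ⟨k, hk⟩ := hKp ⟨_, hx⟩
        refine ⟨k, ?_⟩
        have h2 := congrArg Subtype.val hk
        have h3 : QuotientGroup.mk' (D.subgroupOf N) (x ^ p ^ k) = 1 := by
          rw [map_pow]
          exact h2
        exact (QuotientGroup.eq_one_iff (N := D.subgroupOf N) _).1 h3)
    rw [eq_bot_iff]
    intro y hy
    obtain ⟨x, rfl⟩ := QuotientGroup.mk'_surjective _ y
    exact (QuotientGroup.eq_one_iff (N := D.subgroupOf N) x).2
      (h1 (mem_map_of_mem N.subtype (show x ∈ M' from hy)))

variable [Finite G] [Fact p.Prime]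

/-- A fully normalized subgroup of `S` containing its centralizer in `S` is `p`-centric. -/
theorem isPCentric_of_inf_centralizer_le (S : Sylow p G) (hPS : P ≤ S)
    (hP : IsSylowIn p ((S : Subgroup G) ⊓ normalizer (P : Set G)) (normalizer (P : Set G)))
    (hC : (S : Subgroup G) ⊓ centralizer (P : Set G) ≤ P) : IsPCentric p P := by
  refine ⟨S.2.to_le hPS, ?_⟩
  have h := hP.inf (centralizer_le_normalizer (P : Set G)) (normalizer_le_normalizer_centralizer P)
  rw [inf_assoc, inf_eq_right.2 (centralizer_le_normalizer (P : Set G))] at h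
  rw [map_center_subtype]
  convert h using 1
  exact le_antisymm (inf_le_inf_right _ hPS) (le_inf hC inf_le_right)

/-- If a normal subgroup `M` of `N_G(P)` is covered by `C_G(P)` and its Sylow subgroup
`S ∩ M`, then by the Frattini argument each element of `N_G(P)` acts on `P` as an element which
also normalizes `P (S ∩ M)`. -/
theorem exists_normalizer_sup_of_le_centralizer_sup (S : Sylow p G)
    (hP : IsSylowIn p ((S : Subgroup G) ⊓ normalizer (P : Set G)) (normalizer (P : Set G)))
    (hMN : M ≤ normalizer (P : Set G)) (hNM : normalizer (P : Set G) ≤ normalizer (M : Set G))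
    (hM : M ≤ centralizer (P : Set G) ⊔ ((S : Subgroup G) ⊓ M))
    {n : G} (hn : n ∈ normalizer (P : Set G)) :
    ∃ m ∈ normalizer ((P ⊔ ((S : Subgroup G) ⊓ M) : Subgroup G) : Set G),
      n * m⁻¹ ∈ centralizer (P : Set G) := by
  have h := hP.inf hMN hNM
  rw [inf_assoc, inf_eq_right.2 hMN] at h
  obtain ⟨m, hm, k, hk, rfl⟩ := h.exists_mul_mem_normalizer hNM hn
  have hkP : k ∈ normalizer (P : Set G) := by
    simpa using mul_mem (inv_mem (hMN hm)) hn
  have hRN : (S : Subgroup G) ⊓ M ≤ normalizer (P : Set G) := inf_le_right.trans hMN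
  have hmem : m ∈ ((centralizer (P : Set G) ⊔ ((S : Subgroup G) ⊓ M) : Subgroup G) : Set G) :=
    hM hm
  rw [coe_mul_of_right_le_normalizer_left _ _
    (hRN.trans (normalizer_le_normalizer_centralizer P))] at hmem
  obtain ⟨c, hc, r, hr, rfl⟩ := hmem
  refine ⟨r * k, normalizer_inf_normalizer_le_normalizer_sup _ _ ⟨?_, ?_⟩, ?_⟩
  · exact mul_mem (hRN hr) hkP
  · exact mul_mem (le_normalizer hr) hk
  · have : c * r * k * (r * k)⁻¹ = c := by group
    rw [this]
    exact hc

/-- A fully normalized subgroup `P` of `S` is principal `p`-radical unless all of `N_G(P)` acts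
on `P` through normalizers of strictly larger subgroups of `S`. -/
theorem isPrincipalPRadical_or_exists_gt (S : Sylow p G) (hPS : P ≤ S)
    (hP : IsSylowIn p ((S : Subgroup G) ⊓ normalizer (P : Set G)) (normalizer (P : Set G))) :
    IsPrincipalPRadical p P ∨ ∃ R > P, R ≤ S ∧ ∀ n ∈ normalizer (P : Set G),
      ∃ m ∈ normalizer (R : Set G), n * m⁻¹ ∈ centralizer (P : Set G) := by
  -- It suffices to find a normal subgroup `M` of `N_G(P)`, covered by `C_G(P)` and `S ∩ M`, with
  -- `S ∩ M` not contained in `P`.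
  have key : ∀ M ≤ normalizer (P : Set G), normalizer (P : Set G) ≤ normalizer (M : Set G) →
      M ≤ centralizer (P : Set G) ⊔ ((S : Subgroup G) ⊓ M) →
      ¬ (S : Subgroup G) ⊓ M ≤ P →
      ∃ R > P, R ≤ S ∧ ∀ n ∈ normalizer (P : Set G),
        ∃ m ∈ normalizer (R : Set G), n * m⁻¹ ∈ centralizer (P : Set G) := by
    intro M hMN hNM hM hlt
    exact ⟨_, left_lt_sup.2 hlt, sup_le hPS inf_le_left,
      fun n hn => exists_normalizer_sup_of_le_centralizer_sup S hP hMN hNM hM hn⟩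
  by_cases hC : (S : Subgroup G) ⊓ centralizer (P : Set G) ≤ P
  · by_cases hQ : HasNoNormalPSubgroup p (normalizer (P : Set G) ⧸
      (P ⊔ centralizer (P : Set G)).subgroupOf (normalizer (P : Set G)))
    · exact Or.inl ⟨isPCentric_of_inf_centralizer_le S hPS hP hC, hQ⟩
    · rw [hasNoNormalPSubgroup_normalizer_quotient_iff] at hQ
      push Not at hQ
      obtain ⟨M, hMN, hNM, hDM, hpow, hlt⟩ := hQ
      have hS := hP.inf hMN hNM
      rw [inf_assoc, inf_eq_right.2 hMN] at hS
      have hD : M ≤ normalizer ((P ⊔ centralizer (P : Set G) : Subgroup G) : Set G) :=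
        (le_inf hMN (hMN.trans (normalizer_le_normalizer_centralizer P))).trans
          (normalizer_inf_normalizer_le_normalizer_sup _ _)
      have hM := hS.le_sup_of_pow_mem hDM hD hpow
      refine Or.inr (key M hMN hNM (hM.trans ?_) fun hle => hlt (hM.trans ?_))
      · exact sup_le (sup_le ((le_inf hPS (le_sup_left.trans hDM)).trans le_sup_right)
          le_sup_left) le_sup_right
      · exact sup_le le_rfl (hle.trans le_sup_left)
  · exact Or.inr (key _ (centralizer_le_normalizer (P : Set G))
      (normalizer_le_normalizer_centralizer P) le_sup_left hC)

theorem Sylow.isPrincipalPRadical (S : Sylow p G) : IsPrincipalPRadical p (S : Subgroup G) := by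
  have hS : IsSylowIn p ((S : Subgroup G) ⊓ normalizer ((S : Subgroup G) : Set G))
      (normalizer ((S : Subgroup G) : Set G)) := by
    rw [inf_eq_left.2 le_normalizer]
    exact isSylowIn_iff.2 ⟨le_normalizer, S.2, fun _ _ hR h => S.3 hR h⟩
  refine (isPrincipalPRadical_or_exists_gt S le_rfl hS).resolve_right ?_
  rintro ⟨R, hlt, hle, -⟩
  exact not_le_of_gt hlt hle

end PrincipalPRadical

/-! ### Goldschmidt's family -/

section Goldschmidt

variable {G : Type*} [Group G] [Finite G] {p : ℕ} [Fact p.Prime]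

/-- Burnside's transfer theorem for a central Sylow subgroup. The `p`-complement `L` is described
by the orders of its elements, which shows that it is invariant under automorphisms. -/
theorem exists_normal_complement_of_sylow_le_center {C : Type*} [Group C] [Finite C]
    (Z : Sylow p C) (hZ : (Z : Subgroup C) ≤ center C) :
    ∃ L : Subgroup C, (Nat.card L).Coprime p ∧
      (∀ x, x ∈ L ↔ (orderOf x).Coprime p) ∧ ∀ x, ∃ k, x ^ p ^ k ∈ L := by
  have h : normalizer (Z : Set C) ≤ centralizer (Z : Set C) := fun g _ =>
    mem_centralizer_iff.2 fun z hz => (mem_center_iff.1 (hZ hz) g).symm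
  have hc : (Nat.card (MonoidHom.transferSylow Z h).ker).Coprime p :=
    ((Nat.Prime.coprime_iff_not_dvd Fact.out).2
      (MonoidHom.not_dvd_card_ker_transferSylow Z h)).symm
  have hpow : ∀ x, ∃ k, x ^ p ^ k ∈ (MonoidHom.transferSylow Z h).ker := by
    intro x
    obtain ⟨k, hk⟩ := Z.2 (MonoidHom.transferSylow Z h x)
    exact ⟨k, by rw [MonoidHom.mem_ker, map_pow, hk]⟩
  refine ⟨_, hc, fun x => ⟨fun hx => ?_, fun hx => ?_⟩, hpow⟩
  · refine Nat.Coprime.coprime_dvd_left ?_ hc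
    exact orderOf_dvd_natCard _ hx
  · -- The order of the image of `x` is both prime to `p` and a power of `p`.
    obtain ⟨k, hk⟩ := hpow x
    rw [MonoidHom.mem_ker, map_pow] at hk
    rw [MonoidHom.mem_ker, ← orderOf_eq_one_iff]
    exact Nat.eq_one_of_dvd_coprimes (hx.pow_right k) (orderOf_map_dvd _ x)
      (orderOf_dvd_of_pow_eq_one hk)

/-- If `H` is `p`-centric then some power `x ^ p ^ k` of each `x ∈ H C_G(H)` lies in
`O_{p'}(N_G(H))`. -/
theorem IsPCentric.exists_pow_mem_pPrimeCore {H : Subgroup G} (hH : IsPCentric p H)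
    (x : normalizer (H : Set G)) (hx : (x : G) ∈ H ⊔ centralizer (H : Set G)) :
    ∃ k, x ^ p ^ k ∈ pPrimeCore p (normalizer (H : Set G)) := by
  obtain ⟨hHp, Z, hZ⟩ := hH
  rw [map_center_subtype] at hZ
  have hCN := centralizer_le_normalizer (H : Set G)
  have hZc : (Z : Subgroup (centralizer (H : Set G))) ≤ center _ := by
    intro z hz
    have h1 : (z : G) ∈ H ⊓ centralizer (H : Set G) := hZ ▸ mem_map_of_mem _ hz
    exact mem_center_iff.2 fun c => Subtype.ext (mem_centralizer_iff.1 c.2 _ h1.1).symm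
  obtain ⟨L, hL, hmem, hpow⟩ := exists_normal_complement_of_sylow_le_center Z hZc
  have hLcore : L.map (inclusion hCN) ≤ pPrimeCore p (normalizer (H : Set G)) := by
    refine le_sSup ⟨⟨?_⟩, ?_⟩
    · rintro _ ⟨c, hc, rfl⟩ n
      have hnc : (n : G) * c * (n : G)⁻¹ ∈ centralizer (H : Set G) :=
        (mem_normalizer_iff.1 (normalizer_le_normalizer_centralizer H n.2) c).1 c.2
      refine ⟨⟨_, hnc⟩, ?_, rfl⟩
      have h1 : orderOf (⟨_, hnc⟩ : centralizer (H : Set G)) = orderOf c := by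
        rw [← orderOf_coe, ← orderOf_coe c]
        exact orderOf_injective (MulAut.conj (n : G)).toMonoidHom (MulAut.conj _).injective (c : G)
      exact (hmem _).2 (h1 ▸ (hmem _).1 hc)
    · rwa [card_map_of_injective (inclusion_injective hCN)]
  have hx' : (x : G) ∈ ((H ⊔ centralizer (H : Set G) : Subgroup G) : Set G) := hx
  rw [coe_mul_of_left_le_normalizer_right _ _
    (le_normalizer.trans (normalizer_le_normalizer_centralizer H))] at hx'
  obtain ⟨h, hh, c, hc, hhc⟩ := hx'
  obtain ⟨a, ha⟩ := hHp ⟨h, hh⟩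
  obtain ⟨b, hb⟩ := hpow ⟨c, hc⟩
  have ha' : h ^ p ^ a = 1 := congrArg Subtype.val ha
  -- With `x = h c`, the factor `h` is killed by a power of `p` and the factor `c` is moved
  -- into `L`.
  refine ⟨a + b, hLcore ⟨(⟨c, hc⟩ ^ p ^ b) ^ p ^ a, pow_mem hb _, Subtype.ext ?_⟩⟩
  have hcomm : Commute h c := mem_centralizer_iff.1 hc h hh
  change (c ^ p ^ b) ^ p ^ a = (x : G) ^ p ^ (a + b)
  rw [← hhc]
  change _ = (h * c) ^ p ^ (a + b)
  rw [hcomm.mul_pow, pow_add, pow_mul, ha', one_pow, one_mul, mul_comm, pow_mul]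

theorem goldschmidtFamily_subset_principalFamily (S : Sylow p G) :
    goldschmidtFamily S ⊆ principalFamily S := by
  rintro ⟨H, T⟩ ⟨hHS, hT, P, ⟨-, hN, -⟩, hC, hO, -⟩
  dsimp only at hHS hT hN hC hO
  have hcen : IsPCentric p H := isPCentric_of_inf_centralizer_le S hHS hN hC
  refine ⟨hHS, ⟨hcen, hasNoNormalPSubgroup_normalizer_quotient_iff.2 ?_⟩, hT⟩
  intro M hMN hNM hDM hpow
  have hnorm : (M.subgroupOf (normalizer (H : Set G))).Normal :=
    (normal_subgroupOf_iff_le_normalizer hMN).2 hNM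
  -- `M` maps to a normal `p`-subgroup of `N_G(H) / O_{p'}(N_G(H))`.
  have hMO : M ≤ (pPrimePCore p (normalizer (H : Set G))).map
      (normalizer (H : Set G)).subtype := by
    intro x hx
    refine ⟨⟨x, hMN hx⟩, ?_, rfl⟩
    have hle : (M.subgroupOf (normalizer (H : Set G))).map
        (QuotientGroup.mk' (pPrimeCore p (normalizer (H : Set G)))) ≤ pCore p _ := by
      refine le_sSup ⟨hnorm.map _ (QuotientGroup.mk'_surjective _), ?_⟩
      rintro ⟨_, y, hy, rfl⟩
      obtain ⟨a, ha⟩ := hpow y hy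
      obtain ⟨b, hb⟩ := hcen.exists_pow_mem_pPrimeCore (y ^ p ^ a) ha
      refine ⟨a + b, Subtype.ext ?_⟩
      change (QuotientGroup.mk' (pPrimeCore p (normalizer (H : Set G)))) y ^ p ^ (a + b) = 1
      rw [pow_add, pow_mul, ← map_pow, ← map_pow]
      exact (QuotientGroup.eq_one_iff _).2 hb
    exact hle (mem_map_of_mem _ hx)
  -- Hence `H`, being Sylow in `O_{p',p}(N_G(H))`, is Sylow in `M`.
  have hHM : IsSylowIn p H M := isSylowIn_iff.2 ⟨le_sup_left.trans hDM, hO.isPGroup,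
    fun R hR hRp hHR => hO.eq_of_le (hR.trans hMO) hRp hHR⟩
  have hD : M ≤ normalizer ((H ⊔ centralizer (H : Set G) : Subgroup G) : Set G) :=
    (le_inf hMN (hMN.trans (normalizer_le_normalizer_centralizer H))).trans
      (normalizer_inf_normalizer_le_normalizer_sup _ _)
  exact (hHM.le_sup_of_pow_mem hDM hD hpow).trans (sup_le le_rfl le_sup_left)

end Goldschmidt


/-! ### Alperin's fusion theorem -/

section Alperin

variable {G : Type*} [Group G] {p : ℕ}

theorem conjBy_mul (g h : G) (A : Set G) : conjBy (g * h) A = conjBy h (conjBy g A) := by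
  simp only [conjBy, Set.image_image]
  exact Set.image_congr fun a _ => by group

@[simp] theorem conjBy_one (A : Set G) : conjBy 1 A = A := by
  simp [conjBy]

theorem coe_conjSubgroup (g : G) (H : Subgroup G) :
    (conjSubgroup g H : Set G) = conjBy g (H : Set G) := by
  ext x
  constructor
  · intro hx
    exact ⟨g * x * g⁻¹, hx, by group⟩
  · rintro ⟨a, ha, rfl⟩
    rw [SetLike.mem_coe, mem_conjSubgroup]
    simpa [mul_assoc] using ha

theorem conjBy_mono (g : G) {A B : Set G} (h : A ⊆ B) : conjBy g A ⊆ conjBy g B :=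
  Set.image_mono h

theorem conjBy_eq_self_of_mem_centralizer {c : G} {A : Set G} (hc : c ∈ centralizer A) :
    conjBy c A = A := by
  refine (Set.image_congr fun a ha => ?_).trans (Set.image_id A)
  rw [mul_assoc, mem_centralizer_iff.1 hc a ha, inv_mul_cancel_left, id]

theorem inv_mul_mul_mem_centralizer_conjBy {c x : G} {A : Set G} (hc : c ∈ centralizer A) :
    x⁻¹ * c * x ∈ centralizer (conjBy x A) := by
  rw [mem_centralizer_iff] at *
  rintro _ ⟨a, ha, rfl⟩
  calc x⁻¹ * a * x * (x⁻¹ * c * x) = x⁻¹ * (a * c) * x := by group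
    _ = x⁻¹ * c * x * (x⁻¹ * a * x) := by rw [hc a ha]; group

/-- `FusionGenerated F A g` says that the conjugation `a ↦ g⁻¹ a g` on `A` is a composite of
conjugations by elements `x ∈ T`, each applied to a set contained in `H`, for pairs
`(H, T) ∈ F`. The maps and not merely the images of `A` are compared: `g` is the product of the
elements `x` up to an element centralizing the set it acts on. -/
inductive FusionGenerated (F : Set (Subgroup G × Set G)) : Set G → G → Prop
  | of_mem_centralizer {A : Set G} {c : G} (hc : c ∈ centralizer A) : FusionGenerated F A c
  | step {A : Set G} {HT : Subgroup G × Set G} {x g : G} (hF : HT ∈ F) (hA : A ⊆ HT.1)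
      (hx : x ∈ HT.2) (h : FusionGenerated F (conjBy x A) g) : FusionGenerated F A (x * g)

namespace FusionGenerated

variable {F : Set (Subgroup G × Set G)} {A B : Set G} {g h c : G}

theorem mono (hg : FusionGenerated F B g) (hAB : A ⊆ B) : FusionGenerated F A g := by
  induction hg generalizing A with
  | of_mem_centralizer hc => exact of_mem_centralizer (centralizer_le hAB hc)
  | step hF hA hx _ ih => exact step hF (hAB.trans hA) hx (ih (conjBy_mono _ hAB))

theorem centralizer_mul (hg : FusionGenerated F A g) (hc : c ∈ centralizer A) :
    FusionGenerated F A (c * g) := by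
  induction hg generalizing c with
  | of_mem_centralizer hd => exact of_mem_centralizer (mul_mem hc hd)
  | @step A HT x g hF hA hx _ ih =>
    have := step hF hA hx (ih (inv_mul_mul_mem_centralizer_conjBy (x := x) hc))
    convert this using 1
    group

theorem mul (hg : FusionGenerated F A g) (hh : FusionGenerated F (conjBy g A) h) :
    FusionGenerated F A (g * h) := by
  induction hg with
  | of_mem_centralizer hc =>
    rw [conjBy_eq_self_of_mem_centralizer hc] at hh
    exact hh.centralizer_mul hc
  | step hF hA hx _ ih =>
    rw [mul_assoc]
    rw [conjBy_mul] at hh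
    exact step hF hA hx (ih hh)

theorem of_mem {HT : Subgroup G × Set G} (hF : HT ∈ F) (hA : A ⊆ HT.1) (hg : g ∈ HT.2) :
    FusionGenerated F A g := by
  simpa using step hF hA hg (of_mem_centralizer (one_mem _))

/-- Inverses are available because, for the families in question, `T` is the whole normalizer of
`H`. -/
theorem inv (hF : ∀ HT ∈ F, HT.2 = (normalizer (HT.1 : Set G) : Set G))
    (hg : FusionGenerated F A g) : FusionGenerated F (conjBy g A) g⁻¹ := by
  induction hg with
  | of_mem_centralizer hc =>
    rw [conjBy_eq_self_of_mem_centralizer hc]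
    exact of_mem_centralizer (inv_mem hc)
  | @step A HT x g hHT hA hx _ ih =>
    rw [conjBy_mul, mul_inv_rev]
    refine ih.mul ?_
    rw [← conjBy_mul, mul_inv_cancel, conjBy_one]
    rw [hF HT hHT] at hx
    refine of_mem hHT ?_ ?_
    · rw [← mem_normalizer_iff_conjSubgroup.1 hx, coe_conjSubgroup]
      exact conjBy_mono x hA
    · rw [hF HT hHT]
      exact inv_mem (show _ ∈ normalizer (HT.1 : Set G) from hx)

/-- The sequences underlying a composite of conjugations. -/
theorem exists_chain (hg : FusionGenerated F A g) :
    ∃ (n : ℕ) (HT : Fin n → Subgroup G × Set G) (x : Fin n → G),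
      (∀ i, HT i ∈ F) ∧ conjBy g A = conjBy (Fin.partialProd x (Fin.last n)) A ∧
      (∀ i, x i ∈ (HT i).2) ∧
      ∀ i : Fin n, conjBy (Fin.partialProd x i.castSucc) A ⊆ ((HT i).1 : Set G) := by
  induction hg with
  | @of_mem_centralizer A c hc =>
    refine ⟨0, Fin.elim0, Fin.elim0, fun i => i.elim0, ?_, fun i => i.elim0, fun i => i.elim0⟩
    rw [conjBy_eq_self_of_mem_centralizer hc]
    simp
  | @step A HT x g hF hA hx _ ih =>
    obtain ⟨n, HT', x', h1, h2, h3, h4⟩ := ih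
    refine ⟨n + 1, Fin.cons HT HT', Fin.cons x x', ?_, ?_, ?_, ?_⟩
    · exact Fin.cases hF h1
    · rw [conjBy_mul, h2, ← conjBy_mul, ← Fin.succ_last, Fin.partialProd_succ']
      simp [Fin.tail_cons]
    · exact Fin.cases hx h3
    · refine Fin.cases (by simpa using hA) fun i => ?_
      rw [Fin.castSucc_succ, Fin.partialProd_succ', Fin.tail_cons, Fin.cons_zero,
        Fin.cons_succ, conjBy_mul]
      exact h4 i

end FusionGenerated

variable [Finite G] [Fact p.Prime]

/-- Alperin's fusion theorem for the family of principal `p`-radical subgroups: every conjugation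
from a subgroup of `S` into `S` is generated by the family. -/
theorem fusionGenerated_principalFamily (S : Sylow p G) (P : Subgroup G) (hP : P ≤ S) (g : G)
    (hg : conjSubgroup g P ≤ S) : FusionGenerated (principalFamily S) (P : Set G) g := by
  induction h : Nat.card G - Nat.card P using Nat.strong_induction_on generalizing P g with
  | _ d ihd =>
  have ih : ∀ Q : Subgroup G, Q ≤ S → Nat.card P < Nat.card Q → ∀ g, conjSubgroup g Q ≤ S →
      FusionGenerated (principalFamily S) (Q : Set G) g := by
    intro Q hQ hlt g hg
    have := card_le_card_group Q
    exact ihd _ (by omega) Q hQ g hg rfl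
  have hF : ∀ HT ∈ principalFamily S, HT.2 = (normalizer (HT.1 : Set G) : Set G) :=
    fun HT h => h.2.2
  have card_lt : ∀ {Q R : Subgroup G}, Nat.card Q = Nat.card P → Q < R →
      Nat.card P < Nat.card R := by
    intro Q R hQ hlt
    rw [← hQ]
    exact lt_of_not_ge fun hge => hlt.ne (eq_of_le_of_card_ge hlt.le hge)
  obtain ⟨a, haS, hN⟩ := exists_fullyNormalized_conj S hP
  set P' := conjSubgroup a P with hP'
  have hcard : Nat.card P' = Nat.card P := card_conjSubgroup a
  have haut : ∀ n ∈ normalizer (P' : Set G),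
      FusionGenerated (principalFamily S) (P' : Set G) n := by
    intro n hn
    rcases isPrincipalPRadical_or_exists_gt S haS hN with hrad | ⟨R, hR, hRS, h⟩
    · exact .of_mem (HT := (P', normalizer (P' : Set G))) ⟨haS, hrad, rfl⟩ subset_rfl hn
    · obtain ⟨m, hm, hnm⟩ := h n hn
      have h1 := ih R hRS (card_lt hcard hR) m
        ((mem_normalizer_iff_conjSubgroup.1 hm).le.trans hRS)
      simpa using (h1.mono hR.le).centralizer_mul hnm
  -- A conjugation onto `P'` extends to `N_S(Q)` after an automorphism of `P'`, because `N_S(P')`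
  -- is a Sylow subgroup of `N_G(P')`.
  have hto : ∀ Q : Subgroup G, Q ≤ S → ∀ b, conjSubgroup b Q = P' →
      FusionGenerated (principalFamily S) (Q : Set G) b := by
    intro Q hQ b hb
    have hcQ : Nat.card Q = Nat.card P := by rw [← hcard, ← hb, card_conjSubgroup]
    rcases hQ.eq_or_lt with heq | hlt
    · have hPS : P' = Q :=
        eq_of_le_of_card_ge (haS.trans heq.ge) (hcard.trans hcQ.symm).ge
      rw [← hPS] at hb ⊢
      exact haut b (mem_normalizer_iff_conjSubgroup.2 hb)
    · have hgrow := S.2.lt_inf_normalizer hlt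
      obtain ⟨k, hk, hle⟩ := hN.exists_conjSubgroup_le
        (R := conjSubgroup b ((S : Subgroup G) ⊓ normalizer (Q : Set G)))
        (by
          rw [← hb, ← conjSubgroup_normalizer]
          exact conjSubgroup_mono b inf_le_right)
        ((S.2.to_le inf_le_left).conjSubgroup b)
      rw [← conjSubgroup_mul] at hle
      have h1 := (ih _ inf_le_left (card_lt hcQ hgrow) (b * k)
        (hle.trans inf_le_left)).mono hgrow.le
      have h2 : conjBy (b * k) (Q : Set G) = P' := by
        rw [← coe_conjSubgroup, conjSubgroup_mul, hb, mem_normalizer_iff_conjSubgroup.1 hk]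
      simpa using h1.mul (h := k⁻¹) (h2 ▸ haut _ (inv_mem hk))
  -- Conjugation by `g` is the map `P → P'` followed by the inverse of the map `g⁻¹ P g → P'`.
  have h1 := hto (conjSubgroup g P) hg (g⁻¹ * a) (by rw [← conjSubgroup_mul, mul_inv_cancel_left])
  have h2 := h1.inv hF
  rw [coe_conjSubgroup, ← conjBy_mul, mul_inv_cancel_left] at h2
  simpa using (hto P hP a rfl).mul h2

theorem isWeakConjugationFamily_principalFamily (S : Sylow p G) :
    IsWeakConjugationFamily S (principalFamily S) where
  le_sylow _ h := h.1
  subset_normalizer _ h := h.2.2.le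
  exists_chain A B g hA hB hAB := by
    have hA' : closure A ≤ S := (closure_le _).2 hA
    have hg : conjSubgroup g (closure A) ≤ S := by
      rw [conjSubgroup_le_iff, closure_le]
      intro x hx
      rw [SetLike.mem_coe, mem_conjSubgroup, inv_inv]
      exact hB (hAB ▸ Set.mem_image_of_mem _ hx)
    have hS : ((S : Subgroup G), (normalizer (S : Set G) : Set G)) ∈ principalFamily S :=
      ⟨le_rfl, S.isPrincipalPRadical, rfl⟩
    -- A first step with `x = 1` and `H = S` ensures that the chain is not empty.
    have hgen : FusionGenerated (principalFamily S) A g :=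
      (fusionGenerated_principalFamily S _ hA' g hg).mono subset_closure
    obtain ⟨n, HT, x, h1, h2, h3, h4⟩ := hgen.exists_chain
    refine ⟨n + 1, Fin.cons (S, normalizer (S : Set G)) HT, Fin.cons 1 x, 1, n.succ_pos,
      Fin.cases hS h1, ?_, Fin.cases (one_mem (normalizer (S : Set G))) h3, one_mem _,
      Fin.cases (by simpa using hA) fun i => ?_⟩
    · rw [hAB, h2, ← Fin.succ_last, Fin.partialProd_succ']
      simp [Fin.tail_cons]
    · rw [Fin.castSucc_succ, Fin.partialProd_succ', Fin.tail_cons, Fin.cons_zero, Fin.cons_succ,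
        one_mul]
      exact h4 i

end Alperin

theorem mainTheorem6 {G : Type*} [Group G] [Finite G] (p : ℕ) [Fact p.Prime]
    (hp : p ∣ Nat.card G) (S : Sylow p G) :
    IsWeakConjugationFamily S (principalFamily S) ∧
      goldschmidtFamily S ⊆ principalFamily S :=
  ⟨isWeakConjugationFamily_principalFamily S, goldschmidtFamily_subset_principalFamily S⟩
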